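/- Let $S$ and $E$ be Polish spaces with their Borel $\sigma$-algebras. Let $D=D[0,\infty)$ be the set of right-continuous paths $[0,\infty)\to S$ with left limits, with the $\sigma$-algebra $\mathcal D$ generated by the evaluation maps, and let $\mathbf Z_1,\mathbf Z_2,\dots,\mathbf Z$ be random elements of $(D,\mathcal D)\otimes(E,\mathcal E)$, possibly defined on different probability spaces. For $\mathbf z=((z^s)_{s\in[0,\infty)},z^\infty)\in D\times E$ and $t\in[0,\infty)$ write $\mathbf z^t=(z^s)_{s\in[0,t)}$; the space $H^t$ of all such segments carries the $\sigma$-algebra generated by the evaluations at $s\in[0,t)$. Random elements $X_n$ converge in density to $X$ if, for densities $f_n$, $f$ of their distributions with respect to some common measure $\lambda$, $\liminf_{n\to\infty} f_n=f$ a.e. $\lambda$. A coupling of random elements is a family of random elements on one common probability space with the same respective distributions. (i) Let $0\le t_1\le t_2\le\dots\to\infty$, let $(\hat{\mathbf Z}_1^{t_1},\hat{\mathbf Z}_2^{t_2},\dots,\hat{\mathbf Z})$ be a coupling of $\mathbf Z_1^{t_1},\mathbf Z_2^{t_2},\dots,\mathbf Z$, and let $N$ be an $\mathbb N$-valued random variable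 on the same probability space such that $\hat{\mathbf Z}_n^{t_n}=\hat{\mathbf Z}^{t_n}$ for all $n\ge N$. Then the coupling can be extended to a coupling $(\hat{\mathbf Z}_1,\hat{\mathbf Z}_2,\dots,\hat{\mathbf Z})$ of $\mathbf Z_1,\mathbf Z_2,\dots,\mathbf Z$: there are a probability space $(\Omega',P')$ with a measurable map $\pi$ from $\Omega'$ to the original probability space under which the image of $P'$ is the original probability measure, and random elements $\hat{\mathbf Z}_n$ on $\Omega'$ such that $(\hat{\mathbf Z}_1,\hat{\mathbf Z}_2,\dots,\hat{\mathbf Z}\circ\pi)$ is a coupling of $\mathbf Z_1,\mathbf Z_2,\dots,\mathbf Z$ and, for every $n$, the segment of $\hat{\mathbf Z}_n$ in $[0,t_n)$ is the given $\hat{\mathbf Z}_n^{t_n}\circ\pi$; in particular the segments of $\hat{\mathbf Z}_n$ and $\hat{\mathbf Z}\circ\pi$ in $[0,t_n)$ agree for all $n\ge N\circ\pi$. (ii) Consequently, $\mathbf Z_n^t\to\mathbf Z^t$ in density as $n\to\infty$ for every $t\in[0,\infty)$ if and only if there exist numbers $0\le t_1\le t_2\le\dots\to\infty$, a coupling $(\hat{\mathbf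 Z}_1,\hat{\mathbf Z}_2,\dots,\hat{\mathbf Z})$ of $\mathbf Z_1,\mathbf Z_2,\dots,\mathbf Z$ and an $\mathbb N$-valued random variable $N$ such that $\hat{\mathbf Z}_n^{t_n}=\hat{\mathbf Z}^{t_n}$ for all $n\ge N$. -/

import Mathlib

open MeasureTheory Filter Topology
open scoped NNReal ENNReal

universe uS uE u v w

/-- A path `x : [0,∞) → S` is càdlàg: right-continuous with left limits (at `t = 0` the
left-limit requirement is void, since there `𝓝[<] t` is the trivial filter). -/
def IsCadlag {S : Type*} [TopologicalSpace S] (x : ℝ≥0 → S) : Prop :=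
  ∀ t : ℝ≥0, ContinuousWithinAt x (Set.Ici t) t ∧ ∃ l : S, Tendsto x (𝓝[<] t) (𝓝 l)

/-- The Skorohod space `D[0,∞)` over `S`: the set of càdlàg paths `[0,∞) → S`. -/
def SkorohodSpace (S : Type*) [TopologicalSpace S] : Type _ :=
  {x : ℝ≥0 → S // IsCadlag x}

/-- The σ-algebra `𝒟[0,∞)`: the smallest one making all evaluations `x ↦ x s` measurable. -/
instance SkorohodSpace.instMeasurableSpace (S : Type*) [TopologicalSpace S] [MeasurableSpace S] :
    MeasurableSpace (SkorohodSpace S) :=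
  ⨆ s : ℝ≥0, MeasurableSpace.comap (fun x : SkorohodSpace S => x.1 s) inferInstance

/-- The space `H^t` of path segments `(z^s)_{s ∈ [0,t)}` of elements of `D[0,∞) × E`, i.e. the
restrictions to `[0,t)` of paths in `D[0,∞)`. -/
def WindowSpace (S : Type*) [TopologicalSpace S] (t : ℝ≥0) : Type _ :=
  {w : Set.Iio t → S // ∃ x : SkorohodSpace S, ∀ s : Set.Iio t, x.1 s = w s}

/-- The σ-algebra on `H^t`: the smallest one making all evaluations at `s ∈ [0,t)` measurable. -/
instance WindowSpace.instMeasurableSpace (S : Type*) [TopologicalSpace S] [MeasurableSpace S]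
    (t : ℝ≥0) : MeasurableSpace (WindowSpace S t) :=
  ⨆ s : Set.Iio t, MeasurableSpace.comap (fun w : WindowSpace S t => w.1 s) inferInstance

/-- The segment `z^t = (z^s)_{s ∈ [0,t)}` of `z = ((z^s)_{s ∈ [0,∞)}, z^∞) ∈ D[0,∞) × E`. -/
def timeSegment {S E : Type*} [TopologicalSpace S] (t : ℝ≥0) (z : SkorohodSpace S × E) :
    WindowSpace S t :=
  ⟨fun s => z.1.1 s, z.1, fun _ => rfl⟩

theorem measurable_timeSegment {S E : Type*} [TopologicalSpace S] [MeasurableSpace S]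
    [MeasurableSpace E] (t : ℝ≥0) :
    Measurable (timeSegment t : SkorohodSpace S × E → WindowSpace S t) := by
  refine Measurable.of_le_map (iSup_le fun s => ?_)
  rw [MeasurableSpace.comap_le_iff_le_map]
  intro A hA
  have h : Measurable (fun x : SkorohodSpace S => x.1 (s : ℝ≥0)) :=
    Measurable.of_comap_le
      (le_iSup (fun s : ℝ≥0 => MeasurableSpace.comap
        (fun x : SkorohodSpace S => x.1 s) inferInstance) (s : ℝ≥0))
  exact (h.comp measurable_fst) hA

/-- Convergence in density of distributions `P n` to `Q`: with respect to some measure `l` they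
have densities `f n` and `f` such that `liminf f n = f` almost everywhere `l`. -/
def TendstoInDensity {X : Type*} [MeasurableSpace X] (P : ℕ → Measure X) (Q : Measure X) : Prop :=
  ∃ (l : Measure X) (f : ℕ → X → ℝ≥0∞) (g : X → ℝ≥0∞),
    (∀ n, Measurable (f n)) ∧ Measurable g ∧
    (∀ n, P n = l.withDensity (f n)) ∧ Q = l.withDensity g ∧
    ∀ᵐ x ∂l, liminf (fun n => f n x) atTop = g x

/-- `Y` is a random element, defined on `(Ω, μ)`, with distribution `P`. -/
structure IsRandomElement {Ω X : Type*} [MeasurableSpace Ω] [MeasurableSpace X]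
    (μ : Measure Ω) (Y : Ω → X) (P : Measure X) : Prop where
  measurable : Measurable Y
  map_eq : μ.map Y = P

/-- Window lengths `0 ≤ t_1 ≤ t_2 ≤ … → ∞`. -/
structure IsWidening (t : ℕ → ℝ≥0) : Prop where
  monotone : Monotone t
  tendsto : Tendsto t atTop atTop

/-- `(Y 0, Y 1, …, X)`, defined on the probability space `(Ω, μ)`, is a coupling of
`Z_0^{t_0}, Z_1^{t_1}, …, Z`, where `Z_n` has distribution `P n` and `Z` has distribution `Q`;
and `N` is an `ℕ`-valued random variable such that `Y n = X^{t_n}` for all `n ≥ N`. -/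
structure IsWindowCoupling {S E Ω : Type*} [TopologicalSpace S] [MeasurableSpace S]
    [MeasurableSpace E] [MeasurableSpace Ω]
    (P : ℕ → Measure (SkorohodSpace S × E)) (Q : Measure (SkorohodSpace S × E))
    (t : ℕ → ℝ≥0) (μ : Measure Ω) (Y : (n : ℕ) → Ω → WindowSpace S (t n))
    (X : Ω → SkorohodSpace S × E) (N : Ω → ℕ) : Prop where
  prob : IsProbabilityMeasure μ
  window : ∀ n, IsRandomElement μ (Y n) ((P n).map (timeSegment (t n)))
  limit : IsRandomElement μ X Q
  measurable_time : Measurable N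
  eq_of_le : ∀ ω n, N ω ≤ n → Y n ω = timeSegment (t n) (X ω)

/-- `(Y 0, Y 1, …, X)`, defined on the probability space `(Ω, μ)`, is a coupling of
`Z_0, Z_1, …, Z`, where `Z_n` has distribution `P n` and `Z` has distribution `Q`;
and `N` is an `ℕ`-valued random variable such that `(Y n)^{t_n} = X^{t_n}` for all `n ≥ N`. -/
structure IsFullCoupling {S E Ω : Type*} [TopologicalSpace S] [MeasurableSpace S]
    [MeasurableSpace E] [MeasurableSpace Ω]
    (P : ℕ → Measure (SkorohodSpace S × E)) (Q : Measure (SkorohodSpace S × E))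
    (t : ℕ → ℝ≥0) (μ : Measure Ω) (Y : ℕ → Ω → SkorohodSpace S × E)
    (X : Ω → SkorohodSpace S × E) (N : Ω → ℕ) : Prop where
  prob : IsProbabilityMeasure μ
  element : ∀ n, IsRandomElement μ (Y n) (P n)
  limit : IsRandomElement μ X Q
  measurable_time : Measurable N
  eq_of_le : ∀ ω n, N ω ≤ n → timeSegment (t n) (Y n ω) = timeSegment (t n) (X ω)

/-! Extension (i) rests on `SkorohodSpace S` being standard Borel. A càdlàg path is determined by
its values on a countable dense set `C` of times, and the families in `S^C` that arise are cut out
by countably many conditions on distances. Hence `Z_n` has a regular conditional distribution given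
its segment, which can be sampled as a function of the segment and a uniform variable
(`exists_extension_of_segment`). Appending one independent uniform variable to the given probability
space then completes every window at once.

For (ii), a coupling implies convergence in density because the law of `Z` on `{N ≤ k}` lies below
the law of `Z_n` for all `n ≥ k`. Letting `k → ∞` gives `g ≤ liminf f_n`, and Fatou turns this into
equality, since `g` has mass 1 (`tendstoInDensity_of_eventually_eq`).

Conversely, let `ρ_n = min(f_n, g)/g`, which eventually exceeds every `u < 1` almost everywhere for
the limit law. Draw `X` from the limit law and an independent uniform `U`. Keep the segment of `X`
when `U < ρ_n`, and otherwise draw from the normalized residual law (`exists_residual_map_eq`). On a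
fixed window the segments then agree eventually, almost surely. A Borel–Cantelli diagonal choice
lets the windows grow with `n` (`exists_diagonal_ae_eventually`), and (i) completes the segments to
full elements. -/

theorem MeasurableEmbedding.standardBorelSpace {α β : Type*} [MeasurableSpace α]
    [MeasurableSpace β] [StandardBorelSpace β] {f : α → β} (hf : MeasurableEmbedding f) :
    StandardBorelSpace α := by
  have : StandardBorelSpace (Set.range f) := hf.measurableSet_range.standardBorel
  let _ := upgradeStandardBorel (Set.range f)
  let e : α ≃ᵐ Set.range f := hf.equivRange
  let _ : TopologicalSpace α := TopologicalSpace.induced e inferInstance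
  refine ⟨⟨‹_›, ⟨?_⟩, e.toEquiv.polishSpace_induced⟩⟩
  rw [borel_comap, ← BorelSpace.measurable_eq (α := Set.range f)]
  exact e.measurableEmbedding.comap_eq.symm

/-! ### Càdlàg regularity read off a dense set of times -/

theorem Dense.mem_closure_inter_Ioi {C : Set ℝ≥0} (hC : Dense C) (t : ℝ≥0) :
    t ∈ closure (C ∩ Set.Ioi t) := by
  have h := hC.open_subset_closure_inter (isOpen_Ioi (a := t))
  rw [Set.inter_comm] at h
  refine closure_minimal h isClosed_closure ?_
  rw [closure_Ioi]
  exact Set.self_mem_Ici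

theorem Dense.mem_closure_inter_Iio {C : Set ℝ≥0} (hC : Dense C) {t : ℝ≥0} (ht : t ≠ 0) :
    t ∈ closure (C ∩ Set.Iio t) := by
  have h := hC.open_subset_closure_inter (isOpen_Iio (a := t))
  rw [Set.inter_comm] at h
  refine closure_minimal h isClosed_closure ?_
  rw [closure_Iio' ⟨0, pos_iff_ne_zero.2 ht⟩]
  exact Set.self_mem_Iic

section Regularity

variable {S : Type*} [PseudoMetricSpace S]

/-- Every point `s` of `C` in a short interval `[r, u] ⊆ [0, T]` has a value close to that at `r`
or close to that at `u`. -/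
def HasSmallTwoSidedOscillation (C : Set ℝ≥0) (g : ℝ≥0 → S) : Prop :=
  ∀ k T : ℕ, ∃ n : ℕ, ∀ r ∈ C, ∀ s ∈ C, ∀ u ∈ C, r < s → s < u → u ≤ T →
    u ≤ r + 1 / (n + 1) → dist (g r) (g s) ≤ 1 / (k + 1) ∨ dist (g s) (g u) ≤ 1 / (k + 1)

/-- Right continuity along `C` at the points of `C`. -/
def IsRightContinuousAlong (C : Set ℝ≥0) (g : ℝ≥0 → S) : Prop :=
  ∀ q ∈ C, ∀ k : ℕ, ∃ n : ℕ, ∀ r ∈ C, q < r → r < q + 1 / (n + 1) →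
    dist (g r) (g q) ≤ 1 / (k + 1)

theorem exists_one_div_nat_lt_nnreal {δ : ℝ≥0} (hδ : 0 < δ) : ∃ n : ℕ, 1 / ((n : ℝ≥0) + 1) < δ := by
  obtain ⟨n, hn⟩ := exists_nat_one_div_lt (K := ℝ) (NNReal.coe_pos.2 hδ)
  exact ⟨n, by rw [← NNReal.coe_lt_coe]; simpa using hn⟩

theorem IsCadlag.hasSmallTwoSidedOscillation {x : ℝ≥0 → S} (hx : IsCadlag x) (C : Set ℝ≥0) :
    HasSmallTwoSidedOscillation C x := by
  intro k T
  have he : (0 : ℝ) < 1 / (k + 1) / 2 := by positivity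
  -- Near any `t` the path oscillates little on each side of `t`. Only the jump at `t` can be large,
  -- and three points straddling `t` have two neighbours on the same side.
  have key : ∀ t : ℝ≥0, ∃ U : Set ℝ≥0, IsOpen U ∧ t ∈ U ∧
      (∀ a ∈ U, ∀ b ∈ U, t ≤ a → t ≤ b → dist (x a) (x b) ≤ 1 / (k + 1)) ∧
      (∀ a ∈ U, ∀ b ∈ U, a < t → b < t → dist (x a) (x b) ≤ 1 / (k + 1)) := by
    intro t
    obtain ⟨hr, l, hl⟩ := hx t
    have h1 := mem_nhdsWithin_iff_exists_mem_nhds_inter.1 (hr (Metric.ball_mem_nhds (x t) he))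
    have h2 := mem_nhdsWithin_iff_exists_mem_nhds_inter.1 (hl (Metric.ball_mem_nhds l he))
    obtain ⟨u1, hu1, hu1'⟩ := h1
    obtain ⟨u2, hu2, hu2'⟩ := h2
    obtain ⟨U, hU, hUo, htU⟩ := mem_nhds_iff.1 (inter_mem hu1 hu2)
    refine ⟨U, hUo, htU, fun a ha b hb hta htb => ?_, fun a ha b hb hta htb => ?_⟩
    · have ha' : dist (x a) (x t) < _ := hu1' ⟨(hU ha).1, hta⟩
      have hb' : dist (x b) (x t) < _ := hu1' ⟨(hU hb).1, htb⟩
      have := dist_triangle_right (x a) (x b) (x t)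
      linarith
    · have ha' : dist (x a) l < _ := hu2' ⟨(hU ha).2, hta⟩
      have hb' : dist (x b) l < _ := hu2' ⟨(hU hb).2, htb⟩
      have := dist_triangle_right (x a) (x b) l
      linarith
  choose U hUo htU hU1 hU2 using key
  obtain ⟨δ, hδ, hball⟩ := lebesgue_number_lemma_of_metric (isCompact_Icc (a := (0 : ℝ≥0)) (b := T))
    hUo (fun t _ => Set.mem_iUnion.2 ⟨t, htU t⟩)
  lift δ to ℝ≥0 using hδ.le
  obtain ⟨n, hn⟩ := exists_one_div_nat_lt_nnreal (NNReal.coe_pos.1 hδ)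
  refine ⟨n, fun r _ s _ u _ hrs hsu huT hur => ?_⟩
  obtain ⟨t, ht⟩ := hball r ⟨zero_le, (hrs.le.trans hsu.le).trans huT⟩
  have hmem : ∀ y, r ≤ y → y ≤ u → y ∈ U t := by
    intro y hry hyu
    refine ht ?_
    rw [Metric.mem_ball, NNReal.dist_eq, abs_of_nonneg (sub_nonneg.2 (NNReal.coe_le_coe.2 hry)),
      sub_lt_iff_lt_add', ← NNReal.coe_add, NNReal.coe_lt_coe]
    exact (hyu.trans hur).trans_lt (by gcongr)
  rcases lt_or_ge s t with hst | hst
  · exact Or.inl (hU2 t _ (hmem r le_rfl (hrs.trans hsu).le) _ (hmem s hrs.le hsu.le)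
      (hrs.trans hst) hst)
  · exact Or.inr (hU1 t _ (hmem s hrs.le hsu.le) _ (hmem u (hrs.trans hsu).le le_rfl)
      hst (hst.trans hsu.le))

theorem IsCadlag.isRightContinuousAlong {x : ℝ≥0 → S} (hx : IsCadlag x) (C : Set ℝ≥0) :
    IsRightContinuousAlong C x := by
  intro q _ k
  have he : (0 : ℝ) < 1 / (k + 1) := by positivity
  have h1 := (hx q).1.mono (Set.Ioi_subset_Ici le_rfl) (Metric.ball_mem_nhds (x q) he)
  obtain ⟨v, hv, hv'⟩ := mem_nhdsGT_iff_exists_Ioo_subset.1 h1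
  obtain ⟨n, hn⟩ := exists_one_div_nat_lt_nnreal (tsub_pos_of_lt (Set.mem_Ioi.1 hv))
  refine ⟨n, fun r _ hqr hr => ?_⟩
  have : dist (x r) (x q) < 1 / (k + 1) := hv' ⟨hqr, hr.trans (lt_tsub_iff_left.1 hn)⟩
  exact this.le

/-- Two successive jumps cannot both be large close to `t`. If `g a` and `g b` are far apart, the
triples `a, b, c` and `a, b, d` force both `g c` and `g d` to be close to `g b`, hence to each
other. -/
theorem HasSmallTwoSidedOscillation.dist_lt {C : Set ℝ≥0} {g : ℝ≥0 → S}
    (hg : HasSmallTwoSidedOscillation C g) (t : ℝ≥0) {ε : ℝ} (hε : 0 < ε) :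
    ∃ U ∈ 𝓝 t, ∀ a ∈ C ∩ U, ∀ b ∈ C ∩ U, ∀ c ∈ C ∩ U, ∀ d ∈ C ∩ U, a < b → b < c → c < d →
      dist (g a) (g b) < ε ∨ dist (g c) (g d) < ε := by
  obtain ⟨k, hk⟩ := exists_nat_one_div_lt (half_pos hε)
  obtain ⟨T, hT⟩ := exists_nat_gt (t + 1)
  obtain ⟨n, hn⟩ := hg k T
  set η : ℝ≥0 := 1 / (n + 1) with hη
  have hη0 : 0 < η := by positivity
  have hη1 : η ≤ 1 := by
    rw [hη, div_le_one (by positivity)]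
    simp
  refine ⟨Metric.ball t (η / 2 : ℝ≥0), Metric.ball_mem_nhds _ (by positivity), ?_⟩
  have hd : ∀ y ∈ Metric.ball t (η / 2 : ℝ≥0), y < t + η / 2 ∧ t < y + η / 2 := by
    intro y hy
    rw [Metric.mem_ball, NNReal.dist_eq, abs_lt] at hy
    constructor <;> rw [← NNReal.coe_lt_coe, NNReal.coe_add] <;> linarith [hy.1, hy.2]
  rintro a ⟨haC, ha⟩ b ⟨hbC, hb⟩ c ⟨hcC, hc⟩ d ⟨hdC, hd'⟩ hab hbc hcd
  have hle : ∀ y ∈ Metric.ball t (η / 2 : ℝ≥0), y ≤ T ∧ y ≤ a + η := by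
    intro y hy
    have h1 := (hd y hy).1
    have h2 := (hd a ha).2
    have h3 : t + η / 2 ≤ T := by
      refine le_trans ?_ hT.le
      gcongr
      exact (half_le_self hη0.le).trans hη1
    refine ⟨h1.le.trans h3, ?_⟩
    calc y ≤ t + η / 2 := h1.le
      _ ≤ a + η / 2 + η / 2 := by gcongr
      _ = a + η := by rw [add_assoc, add_halves]
  by_contra! hcon
  obtain ⟨h1, h2⟩ := hcon
  have habc := hn a haC b hbC c hcC hab hbc (hle c hc).1 (hle c hc).2
  have habd := hn a haC b hbC d hdC hab (hbc.trans hcd) (hle d hd').1 (hle d hd').2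
  have hbc' : dist (g b) (g c) ≤ 1 / (k + 1) := by
    rcases habc with h | h
    · linarith
    · exact h
  have hbd' : dist (g b) (g d) ≤ 1 / (k + 1) := by
    rcases habd with h | h
    · linarith
    · exact h
  have := dist_triangle_left (g c) (g d) (g b)
  linarith

theorem exists_lt_of_not_dist_lt {A : Set ℝ≥0} {g : ℝ≥0 → S} {ε : ℝ} (hε : 0 < ε)
    (h : ∃ a ∈ A, ∃ b ∈ A, ε ≤ dist (g a) (g b)) :
    ∃ a ∈ A, ∃ b ∈ A, a < b ∧ ε ≤ dist (g a) (g b) := by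
  obtain ⟨a, ha, b, hb, hab⟩ := h
  rcases lt_trichotomy a b with h | h | h
  · exact ⟨a, ha, b, hb, h, hab⟩
  · subst h
    simp only [dist_self] at hab
    linarith
  · exact ⟨b, hb, a, ha, h, by rwa [dist_comm]⟩

/-- If the Cauchy property failed, a distant pair `c < d` could be found near `t`, and then another
pair `a < b` between `t` and `c`. This contradicts `HasSmallTwoSidedOscillation.dist_lt`. -/
theorem HasSmallTwoSidedOscillation.exists_tendsto_right [CompleteSpace S] {C : Set ℝ≥0}
    (hC : Dense C) {g : ℝ≥0 → S} (hg : HasSmallTwoSidedOscillation C g) (t : ℝ≥0) :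
    ∃ a, Tendsto g (𝓝[C ∩ Set.Ioi t] t) (𝓝 a) := by
  have hne : (𝓝[C ∩ Set.Ioi t] t).NeBot :=
    mem_closure_iff_nhdsWithin_neBot.1 (hC.mem_closure_inter_Ioi _)
  refine cauchy_map_iff_exists_tendsto.1 (Metric.cauchy_iff.2 ⟨hne.map _, fun ε hε => ?_⟩)
  by_contra! hcon
  have hbad : ∀ A ∈ 𝓝[C ∩ Set.Ioi t] t, ∃ a ∈ A, ∃ b ∈ A, a < b ∧ ε ≤ dist (g a) (g b) := by
    intro A hA
    obtain ⟨_, ⟨a, ha, rfl⟩, _, ⟨b, hb, rfl⟩, h⟩ := hcon _ (image_mem_map hA)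
    exact exists_lt_of_not_dist_lt hε ⟨a, ha, b, hb, h⟩
  obtain ⟨U, hU, h⟩ := hg.dist_lt t hε
  have hA : (C ∩ Set.Ioi t) ∩ U ∈ 𝓝[C ∩ Set.Ioi t] t :=
    inter_mem self_mem_nhdsWithin (mem_nhdsWithin_of_mem_nhds hU)
  obtain ⟨c, hc, d, hd, hcd, hcd'⟩ := hbad _ hA
  obtain ⟨a, ha, b, hb, hab, hab'⟩ := hbad _
    (inter_mem hA (mem_nhdsWithin_of_mem_nhds (Iio_mem_nhds hc.1.2)))
  rcases h a ⟨ha.1.1.1, ha.1.2⟩ b ⟨hb.1.1.1, hb.1.2⟩ c ⟨hc.1.1, hc.2⟩ d ⟨hd.1.1, hd.2⟩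
    hab hb.2 hcd with h | h <;> linarith

theorem HasSmallTwoSidedOscillation.exists_tendsto_left [CompleteSpace S] {C : Set ℝ≥0}
    (hC : Dense C) {g : ℝ≥0 → S} (hg : HasSmallTwoSidedOscillation C g) (t : ℝ≥0) :
    ∃ a, Tendsto g (𝓝[C ∩ Set.Iio t] t) (𝓝 a) := by
  rcases eq_or_ne t 0 with rfl | ht
  · refine ⟨g 0, ?_⟩
    have : C ∩ Set.Iio (0 : ℝ≥0) = ∅ := by
      ext y
      simp
    rw [this, nhdsWithin_empty]
    exact tendsto_bot
  have hne : (𝓝[C ∩ Set.Iio t] t).NeBot :=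
    mem_closure_iff_nhdsWithin_neBot.1 (hC.mem_closure_inter_Iio ht)
  refine cauchy_map_iff_exists_tendsto.1 (Metric.cauchy_iff.2 ⟨hne.map _, fun ε hε => ?_⟩)
  by_contra! hcon
  have hbad : ∀ A ∈ 𝓝[C ∩ Set.Iio t] t, ∃ a ∈ A, ∃ b ∈ A, a < b ∧ ε ≤ dist (g a) (g b) := by
    intro A hA
    obtain ⟨_, ⟨a, ha, rfl⟩, _, ⟨b, hb, rfl⟩, h⟩ := hcon _ (image_mem_map hA)
    exact exists_lt_of_not_dist_lt hε ⟨a, ha, b, hb, h⟩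
  obtain ⟨U, hU, h⟩ := hg.dist_lt t hε
  have hA : (C ∩ Set.Iio t) ∩ U ∈ 𝓝[C ∩ Set.Iio t] t :=
    inter_mem self_mem_nhdsWithin (mem_nhdsWithin_of_mem_nhds hU)
  obtain ⟨a, ha, b, hb, hab, hab'⟩ := hbad _ hA
  obtain ⟨c, hc, d, hd, hcd, hcd'⟩ := hbad _
    (inter_mem hA (mem_nhdsWithin_of_mem_nhds (Ioi_mem_nhds hb.1.2)))
  rcases h a ⟨ha.1.1, ha.2⟩ b ⟨hb.1.1, hb.2⟩ c ⟨hc.1.1.1, hc.1.2⟩ d ⟨hd.1.1.1, hd.1.2⟩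
    hab hc.2 hcd with h | h <;> linarith

/-- If `x` is the right limit of `g` along `C` everywhere, then limits of `g` along `C` inside an
open set are limits of `x` inside that set. -/
theorem tendsto_of_rightLimit {C : Set ℝ≥0} (hC : Dense C) {g x : ℝ≥0 → S}
    (hx : ∀ t, Tendsto g (𝓝[C ∩ Set.Ioi t] t) (𝓝 (x t))) {O : Set ℝ≥0} (hO : IsOpen O)
    {t : ℝ≥0} {a : S} (h : Tendsto g (𝓝[C ∩ O] t) (𝓝 a)) : Tendsto x (𝓝[O] t) (𝓝 a) := by
  rw [(Metric.nhds_basis_closedBall).tendsto_right_iff]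
  intro ε hε
  obtain ⟨U, hU, hU'⟩ := mem_nhdsWithin_iff_exists_mem_nhds_inter.1
    (h (Metric.closedBall_mem_nhds a hε))
  obtain ⟨V, hVU, hVo, htV⟩ := mem_nhds_iff.1 hU
  filter_upwards [inter_mem self_mem_nhdsWithin (mem_nhdsWithin_of_mem_nhds (hVo.mem_nhds htV))]
    with s hs
  -- `x s` is a limit of values of `g` at points of `C` near `s`, all in the closed ball. Closed
  -- balls are used because they survive this limit.
  have hne : (𝓝[C ∩ Set.Ioi s] s).NeBot :=
    mem_closure_iff_nhdsWithin_neBot.1 (hC.mem_closure_inter_Ioi _)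
  refine Metric.isClosed_closedBall.mem_of_tendsto (hx s) ?_
  filter_upwards [self_mem_nhdsWithin,
    mem_nhdsWithin_of_mem_nhds ((hO.inter hVo).mem_nhds hs)] with r hr hr'
  exact hU' ⟨hVU hr'.2, hr.1, hr'.1⟩

/-- The extension is the right limit of `g` along `C`. Right continuity along `C` is what makes it
agree with `g` on `C` itself. -/
theorem exists_isCadlag_eqOn [CompleteSpace S] [T2Space S] {C : Set ℝ≥0} (hC : Dense C)
    {g : ℝ≥0 → S} (hg : HasSmallTwoSidedOscillation C g) (hr : IsRightContinuousAlong C g) :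
    ∃ x : ℝ≥0 → S, IsCadlag x ∧ Set.EqOn x g C := by
  choose x hx using fun t => hg.exists_tendsto_right hC t
  refine ⟨x, fun t => ⟨?_, ?_⟩, fun q hq => ?_⟩
  · rw [← continuousWithinAt_Ioi_iff_Ici]
    exact tendsto_of_rightLimit hC hx isOpen_Ioi (hx t)
  · obtain ⟨l, hl⟩ := hg.exists_tendsto_left hC t
    exact ⟨l, tendsto_of_rightLimit hC hx isOpen_Iio hl⟩
  · have hne : (𝓝[C ∩ Set.Ioi q] q).NeBot :=
      mem_closure_iff_nhdsWithin_neBot.1 (hC.mem_closure_inter_Ioi _)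
    refine tendsto_nhds_unique (hx q) ?_
    rw [Metric.tendsto_nhds]
    intro ε hε
    obtain ⟨k, hk⟩ := exists_nat_one_div_lt hε
    obtain ⟨n, hn⟩ := hr q hq k
    have hmem : Set.Iio (q + 1 / ((n : ℝ≥0) + 1)) ∈ 𝓝 q :=
      Iio_mem_nhds (lt_add_of_pos_right _ (by positivity))
    filter_upwards [self_mem_nhdsWithin, mem_nhdsWithin_of_mem_nhds hmem] with r hr1 hr2
    exact (hn r hr1.1 hr1.2 hr2).trans_lt hk

end Regularity

/-! ### The Skorohod space is standard Borel -/

theorem SkorohodSpace.measurable_eval {S : Type*} [TopologicalSpace S] [MeasurableSpace S]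
    (s : ℝ≥0) : Measurable (fun x : SkorohodSpace S => x.1 s) :=
  Measurable.of_comap_le (le_iSup (fun s : ℝ≥0 => MeasurableSpace.comap
    (fun x : SkorohodSpace S => x.1 s) inferInstance) s)

theorem SkorohodSpace.measurable_of_eval {S α : Type*} [TopologicalSpace S] [MeasurableSpace S]
    [MeasurableSpace α] {f : α → SkorohodSpace S} (h : ∀ s, Measurable (fun a => (f a).1 s)) :
    Measurable f := by
  refine Measurable.of_le_map (iSup_le fun s => ?_)
  rw [MeasurableSpace.comap_le_iff_le_map]
  exact fun A hA => h s hA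

/-- One sequence serves all paths simultaneously, so evaluation at `t` is a pointwise limit of
evaluations at points of `C`. -/
theorem SkorohodSpace.exists_seq_tendsto {S : Type*} [TopologicalSpace S] {C : Set ℝ≥0}
    (hC : Dense C) (t : ℝ≥0) : ∃ c : ℕ → ℝ≥0, (∀ n, c n ∈ C) ∧
      ∀ x : SkorohodSpace S, Tendsto (fun n => x.1 (c n)) atTop (𝓝 (x.1 t)) := by
  obtain ⟨c, hc, hct⟩ := mem_closure_iff_seq_limit.1 (hC.mem_closure_inter_Ioi t)
  refine ⟨c, fun n => (hc n).1, fun x => ?_⟩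
  refine Tendsto.comp (x.2 t).1 (tendsto_nhdsWithin_iff.2 ⟨hct, Eventually.of_forall fun n => ?_⟩)
  exact le_of_lt (Set.mem_Ioi.1 (hc n).2)

instance SkorohodSpace.instStandardBorelSpace (S : Type*) [TopologicalSpace S] [PolishSpace S]
    [MeasurableSpace S] [BorelSpace S] : StandardBorelSpace (SkorohodSpace S) := by
  classical
  let _ := TopologicalSpace.upgradeIsCompletelyMetrizable S
  obtain ⟨C, hCc, hC⟩ := TopologicalSpace.exists_countable_dense ℝ≥0
  have : Countable C := hCc.to_subtype
  let φ : SkorohodSpace S → (C → S) := fun x c => x.1 c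
  have hφ : Measurable φ := measurable_pi_lambda _ fun c => SkorohodSpace.measurable_eval _
  refine MeasurableEmbedding.standardBorelSpace (f := φ)
    (MeasurableEmbedding.iff_comap_eq.2 ⟨fun x y hxy => ?_, le_antisymm hφ.comap_le ?_, ?_⟩)
  · refine Subtype.ext (funext fun t => ?_)
    obtain ⟨c, hc, hct⟩ := SkorohodSpace.exists_seq_tendsto (S := S) hC t
    refine tendsto_nhds_unique (hct x) ((hct y).congr fun n => ?_)
    exact (congrFun hxy ⟨c n, hc n⟩).symm
  · refine iSup_le fun t => ?_
    obtain ⟨c, hc, hct⟩ := SkorohodSpace.exists_seq_tendsto (S := S) hC t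
    suffices h : Measurable[MeasurableSpace.comap φ inferInstance]
        (fun x : SkorohodSpace S => x.1 t) from h.comap_le
    let _ : MeasurableSpace (SkorohodSpace S) := MeasurableSpace.comap φ inferInstance
    refine measurable_of_tendsto_metrizable (f := fun n (x : SkorohodSpace S) => x.1 (c n))
      (fun n => ?_) (tendsto_pi_nhds.2 hct)
    exact (measurable_pi_apply (⟨c n, hc n⟩ : C)).comp (comap_measurable φ)
  -- All quantifiers range over `ℕ` or the countable set `C`, so this description makes the range
  -- measurable.
  · have hrange : Set.range φ =
        {f | ∀ k T : ℕ, ∃ n : ℕ, ∀ r s u : C, r < s → s < u → (u : ℝ≥0) ≤ T →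
          (u : ℝ≥0) ≤ r + 1 / (n + 1) →
          dist (f r) (f s) ≤ 1 / (k + 1) ∨ dist (f s) (f u) ≤ 1 / (k + 1)} ∩
        {f | ∀ q : C, ∀ k : ℕ, ∃ n : ℕ, ∀ r : C, q < r → (r : ℝ≥0) < q + 1 / (n + 1) →
          dist (f r) (f q) ≤ 1 / (k + 1)} := by
      ext f
      constructor
      · rintro ⟨x, rfl⟩
        refine ⟨fun k T => ?_, fun q k => ?_⟩
        · obtain ⟨n, hn⟩ := x.2.hasSmallTwoSidedOscillation C k T
          exact ⟨n, fun r s u => hn r r.2 s s.2 u u.2⟩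
        · obtain ⟨n, hn⟩ := x.2.isRightContinuousAlong C q q.2 k
          exact ⟨n, fun r => hn r r.2⟩
      · rintro ⟨h1, h2⟩
        obtain ⟨c0, hc0⟩ := hC.nonempty
        let g : ℝ≥0 → S := fun t => if ht : t ∈ C then f ⟨t, ht⟩ else f ⟨c0, hc0⟩
        have hg : ∀ c : C, g c = f c := fun c => dif_pos c.2
        have hg1 : HasSmallTwoSidedOscillation C g := by
          intro k T
          obtain ⟨n, hn⟩ := h1 k T
          refine ⟨n, fun r hr s hs u hu hrs hsu hT hur => ?_⟩
          simpa only [← hg] using hn ⟨r, hr⟩ ⟨s, hs⟩ ⟨u, hu⟩ hrs hsu hT hur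
        have hg2 : IsRightContinuousAlong C g := by
          intro q hq k
          obtain ⟨n, hn⟩ := h2 ⟨q, hq⟩ k
          refine ⟨n, fun r hr hqr hrn => ?_⟩
          simpa only [← hg] using hn ⟨r, hr⟩ hqr hrn
        obtain ⟨x, hx, hxg⟩ := exists_isCadlag_eqOn hC hg1 hg2
        exact ⟨⟨x, hx⟩, funext fun c => (hxg c.2).trans (hg c)⟩
    have hd : ∀ (r s : C) (k : ℕ), MeasurableSet {f : C → S | dist (f r) (f s) ≤ 1 / (k + 1)} :=
      fun r s k => measurableSet_le ((measurable_pi_apply r).dist (measurable_pi_apply s))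
        measurable_const
    rw [hrange]
    refine MeasurableSet.inter ?_ ?_
    · simp only [Set.ofPred_forall, Set.ofPred_exists, Set.ofPred_or]
      refine .iInter fun k => .iInter fun T => .iUnion fun n => .iInter fun r => .iInter fun s =>
        .iInter fun u => .iInter fun _ => .iInter fun _ => .iInter fun _ => .iInter fun _ =>
        (hd _ _ _).union (hd _ _ _)
    · simp only [Set.ofPred_forall, Set.ofPred_exists]
      refine .iInter fun q => .iInter fun k => .iUnion fun n => .iInter fun r =>
        .iInter fun _ => .iInter fun _ => hd _ _ _

/-! ### Segments and gluing -/

theorem WindowSpace.measurable_eval {S : Type*} [TopologicalSpace S] [MeasurableSpace S] {t : ℝ≥0}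
    (s : Set.Iio t) : Measurable (fun x : WindowSpace S t => x.1 s) :=
  Measurable.of_comap_le (le_iSup (fun s : Set.Iio t => MeasurableSpace.comap
    (fun x : WindowSpace S t => x.1 s) inferInstance) s)

/-- The path that follows the segment `w` on `[0,t)` and the path `x` on `[t,∞)`. -/
noncomputable def SkorohodSpace.glue {S : Type*} [TopologicalSpace S] (t : ℝ≥0)
    (w : WindowSpace S t) (x : SkorohodSpace S) : SkorohodSpace S :=
  ⟨fun s => if h : s < t then w.1 ⟨s, h⟩ else x.1 s, by
    obtain ⟨y, hy⟩ := w.2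
    have hpath : (fun s => if h : s < t then w.1 ⟨s, h⟩ else x.1 s) =
        fun s => if s < t then y.1 s else x.1 s := by
      funext s
      split_ifs with h
      · exact (hy ⟨s, h⟩).symm
      · rfl
    rw [hpath]
    intro r
    -- At `r = t` right continuity comes from `x`, the left limit from the path `y` behind the
    -- segment.
    constructor
    · rcases lt_or_ge r t with hr | hr
      · refine (y.2 r).1.congr_of_eventuallyEq ?_ (if_pos hr)
        filter_upwards [mem_nhdsWithin_of_mem_nhds (Iio_mem_nhds hr)] with s hs using if_pos hs
      · exact (x.2 r).1.congr (fun s hs => if_neg (not_lt.2 (hr.trans hs))) (if_neg (not_lt.2 hr))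
    · rcases le_or_gt r t with hr | hr
      · obtain ⟨l, hl⟩ := (y.2 r).2
        refine ⟨l, hl.congr' ?_⟩
        filter_upwards [self_mem_nhdsWithin] with s hs
          using (if_pos (lt_of_lt_of_le (Set.mem_Iio.1 hs) hr)).symm
      · obtain ⟨l, hl⟩ := (x.2 r).2
        refine ⟨l, hl.congr' ?_⟩
        filter_upwards [mem_nhdsWithin_of_mem_nhds (Ioi_mem_nhds hr)] with s hs
          using (if_neg (not_lt.2 (le_of_lt (Set.mem_Ioi.1 hs)))).symm⟩

theorem SkorohodSpace.measurable_glue {S : Type*} [TopologicalSpace S] [MeasurableSpace S]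
    (t : ℝ≥0) :
    Measurable fun p : WindowSpace S t × SkorohodSpace S => SkorohodSpace.glue t p.1 p.2 := by
  refine SkorohodSpace.measurable_of_eval fun s => ?_
  by_cases h : s < t
  · simpa only [SkorohodSpace.glue, h, dite_true, Function.comp_def] using
      (WindowSpace.measurable_eval ⟨s, h⟩).comp measurable_fst
  · simpa only [SkorohodSpace.glue, h, dite_false, Function.comp_def] using
      (SkorohodSpace.measurable_eval s).comp measurable_snd

section Glue

variable {S E : Type*} [TopologicalSpace S]

theorem timeSegment_glue (t : ℝ≥0) (w : WindowSpace S t) (x : SkorohodSpace S) (e : E) :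
    timeSegment t (SkorohodSpace.glue t w x, e) = w :=
  Subtype.ext (funext fun s => dif_pos s.2)

theorem glue_timeSegment (t : ℝ≥0) (z : SkorohodSpace S × E) :
    SkorohodSpace.glue t (timeSegment t z) z.1 = z.1 := by
  refine Subtype.ext (funext fun s => ?_)
  by_cases h : s < t
  · exact dif_pos h
  · exact dif_neg h

theorem timeSegment_eq_of_le {s t : ℝ≥0} (hst : s ≤ t) {z z' : SkorohodSpace S × E}
    (h : timeSegment t z = timeSegment t z') : timeSegment s z = timeSegment s z' :=
  Subtype.ext (funext fun r => congrFun (congrArg Subtype.val h) ⟨r.1, lt_of_lt_of_le r.2 hst⟩)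

end Glue

/-! ### Extending a coupling of windows -/

open ProbabilityTheory unitInterval in
/-- Every random element `Y` distributed as the segment of `Z ∼ P` extends, by means of an
independent uniform variable, to a full random element with distribution `P`. -/
theorem exists_extension_of_segment {S : Type*} [TopologicalSpace S] [PolishSpace S]
    [MeasurableSpace S] [BorelSpace S] {E : Type*} [MeasurableSpace E] [StandardBorelSpace E]
    (P : Measure (SkorohodSpace S × E)) [IsProbabilityMeasure P] (t : ℝ≥0) :
    ∃ F : WindowSpace S t × I → SkorohodSpace S × E, Measurable F ∧
      (∀ p, timeSegment t (F p) = p.1) ∧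
      ((P.map (timeSegment t)).prod volume).map F = P := by
  have : Nonempty (SkorohodSpace S × E) := P.nonempty_of_neZero
  have hseg := measurable_timeSegment (S := S) (E := E) t
  obtain ⟨f, hf, hfκ⟩ :=
    Kernel.exists_measurable_map_eq_unitInterval (condDistrib id (timeSegment t) P)
  -- A conditional sample has the prescribed segment only almost surely. Overwriting its initial
  -- part makes this exact everywhere and leaves the law `P` unchanged.
  let G : WindowSpace S t × (SkorohodSpace S × E) → SkorohodSpace S × E :=
    fun p => (SkorohodSpace.glue t p.1 p.2.1, p.2.2)
  have hG : Measurable G := by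
    refine Measurable.prodMk ?_ (by fun_prop)
    exact (SkorohodSpace.measurable_glue t).comp
      (measurable_fst.prodMk (measurable_fst.comp measurable_snd))
  let H : WindowSpace S t × I → WindowSpace S t × (SkorohodSpace S × E) :=
    fun p => (p.1, f p.1 p.2)
  have hH : Measurable H := measurable_fst.prodMk hf
  have hHmap : ((P.map (timeSegment t)).prod volume).map H = P.map fun z => (timeSegment t z, z) := by
    refine Eq.trans ?_ (compProd_map_condDistrib (mβ := inferInstance) (μ := P)
      (X := timeSegment t) (Y := id) aemeasurable_id)
    have : IsProbabilityMeasure (P.map (timeSegment t)) :=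
      Measure.isProbabilityMeasure_map hseg.aemeasurable
    ext B hB
    rw [Measure.map_apply hH hB, Measure.prod_apply (hH hB), Measure.compProd_apply hB]
    refine lintegral_congr fun w => ?_
    rw [← hfκ w, Measure.map_apply hf.of_uncurry_left (measurable_prodMk_left hB)]
    rfl
  refine ⟨G ∘ H, hG.comp hH, fun p => timeSegment_glue t _ _ _, ?_⟩
  rw [← Measure.map_map hG hH, hHmap, Measure.map_map hG (by fun_prop)]
  convert Measure.map_id using 2
  funext z
  exact Prod.ext (glue_timeSegment t z) rfl

/-- Only the marginal law of each completed element is prescribed, so the same uniform variable can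
be used for every `n`. -/
theorem exists_fullCoupling_of_windowCoupling {S : Type uS} [TopologicalSpace S] [PolishSpace S]
    [MeasurableSpace S] [BorelSpace S] {E : Type uE} [MeasurableSpace E] [StandardBorelSpace E]
    (P : ℕ → Measure (SkorohodSpace S × E)) [∀ n, IsProbabilityMeasure (P n)]
    (Q : Measure (SkorohodSpace S × E)) (t : ℕ → ℝ≥0) (Ω : Type w) [MeasurableSpace Ω]
    (μ : Measure Ω) (Y : (n : ℕ) → Ω → WindowSpace S (t n)) (X : Ω → SkorohodSpace S × E)
    (N : Ω → ℕ) (h : IsWindowCoupling P Q t μ Y X N) :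
    ∃ (Ω' : Type w) (_ : MeasurableSpace Ω') (μ' : Measure Ω') (π : Ω' → Ω)
      (Y' : ℕ → Ω' → SkorohodSpace S × E),
      MeasurePreserving π μ' μ ∧ IsFullCoupling P Q t μ' Y' (X ∘ π) (N ∘ π) ∧
      ∀ n ω', timeSegment (t n) (Y' n ω') = Y n (π ω') := by
  have := h.prob
  choose F hF hFseg hFmap using fun n => exists_extension_of_segment (P n) (t n)
  have hfst : MeasurePreserving (Prod.fst : Ω × unitInterval → Ω) (μ.prod volume) μ :=
    measurePreserving_fst
  have hY' : ∀ n, Measurable fun ω : Ω × unitInterval => (Y n ω.1, ω.2) := fun n =>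
    ((h.window n).measurable.comp measurable_fst).prodMk measurable_snd
  refine ⟨Ω × unitInterval, inferInstance, μ.prod volume, Prod.fst,
    fun n ω => F n (Y n ω.1, ω.2), hfst, ⟨inferInstance, fun n => ⟨(hF n).comp (hY' n), ?_⟩,
      ⟨h.limit.measurable.comp measurable_fst, ?_⟩, h.measurable_time.comp measurable_fst, ?_⟩,
    fun n ω => hFseg n _⟩
  · have hpres : MeasurePreserving (Prod.map (Y n) (id : unitInterval → unitInterval))
        (μ.prod volume) (((P n).map (timeSegment (t n))).prod volume) := by
      have hYn : MeasurePreserving (Y n) μ ((P n).map (timeSegment (t n))) :=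
        ⟨(h.window n).measurable, (h.window n).map_eq⟩
      exact hYn.prod (MeasurePreserving.id volume)
    have := (hpres.map_eq ▸ hFmap n)
    rwa [Measure.map_map (hF n) hpres.measurable] at this
  · rw [← Measure.map_map h.limit.measurable measurable_fst, hfst.map_eq, h.limit.map_eq]
  · intro ω n hn
    rw [hFseg]
    exact h.eq_of_le ω.1 n hn

/-! ### From couplings to convergence in density -/

/-- If random elements `Y n` on one probability space agree with `Z` from a random time on, then
they converge to `Z` in density. -/
theorem tendstoInDensity_of_eventually_eq {Ω X : Type*} [MeasurableSpace Ω] [MeasurableSpace X]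
    (μ : Measure Ω) [IsProbabilityMeasure μ] {Y : ℕ → Ω → X} {Z : Ω → X} {N : Ω → ℕ}
    (hY : ∀ n, Measurable (Y n)) (hZ : Measurable Z) (hN : Measurable N)
    (h : ∀ ω n, N ω ≤ n → Y n ω = Z ω) :
    TendstoInDensity (fun n => μ.map (Y n)) (μ.map Z) := by
  have hprob : ∀ n, IsProbabilityMeasure (μ.map (Y n)) := fun n =>
    Measure.isProbabilityMeasure_map (hY n).aemeasurable
  have hprobZ : IsProbabilityMeasure (μ.map Z) := Measure.isProbabilityMeasure_map hZ.aemeasurable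
  -- The sum has infinite mass and need not be σ-finite, so it is replaced by a finite measure with
  -- respect to which every law has a Radon–Nikodym density.
  let l : Measure X := (μ.map Z + Measure.sum fun n => μ.map (Y n)).toFinite
  have hl : μ.map Z + Measure.sum (fun n => μ.map (Y n)) ≪ l := absolutelyContinuous_toFinite _
  have hPl : ∀ n, μ.map (Y n) ≪ l := fun n =>
    (Measure.absolutelyContinuous_of_le ((Measure.le_sum _ n).trans
      (Measure.le_add_left le_rfl))).trans hl
  have hQl : μ.map Z ≪ l :=
    (Measure.absolutelyContinuous_of_le (Measure.le_add_right le_rfl)).trans hl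
  let f : ℕ → X → ℝ≥0∞ := fun n => (μ.map (Y n)).rnDeriv l
  have hf : ∀ n, Measurable (f n) := fun n => Measure.measurable_rnDeriv _ _
  have hfP : ∀ n, l.withDensity (f n) = μ.map (Y n) := fun n =>
    Measure.withDensity_rnDeriv_eq _ _ (hPl n)
  let g : X → ℝ≥0∞ := (μ.map Z).rnDeriv l
  have hg : Measurable g := Measure.measurable_rnDeriv _ _
  have hgQ : l.withDensity g = μ.map Z := Measure.withDensity_rnDeriv_eq _ _ hQl
  have hNk : ∀ k, MeasurableSet {ω | N ω ≤ k} := fun k => hN measurableSet_Iic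
  let σ : ℕ → Measure X := fun k => (μ.restrict {ω | N ω ≤ k}).map Z
  have hσP : ∀ k n, k ≤ n → σ k ≤ μ.map (Y n) := by
    intro k n hkn
    have : σ k = (μ.restrict {ω | N ω ≤ k}).map (Y n) := by
      refine Measure.map_congr ?_
      filter_upwards [ae_restrict_mem (hNk k)] with ω hω
      exact (h ω n (le_trans hω hkn)).symm
    rw [this]
    exact Measure.map_mono Measure.restrict_le_self (hY n)
  have hσl : ∀ k, σ k ≪ l := fun k =>
    (Measure.absolutelyContinuous_of_le (hσP k k le_rfl)).trans (hPl k)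
  have hσs : ∀ k, l.withDensity ((σ k).rnDeriv l) = σ k := fun k =>
    Measure.withDensity_rnDeriv_eq _ _ (hσl k)
  have hliminf : Measurable fun x => liminf (fun n => f n x) atTop := Measurable.liminf hf
  have hσf : ∀ᵐ x ∂l, ∀ k n, k ≤ n → (σ k).rnDeriv l x ≤ f n x := by
    refine ae_all_iff.2 fun k => ae_all_iff.2 fun n => ?_
    by_cases hkn : k ≤ n
    · have : (σ k).rnDeriv l ≤ᵐ[l] f n := by
        refine ae_le_of_forall_setLIntegral_le_of_sigmaFinite (Measure.measurable_rnDeriv _ _)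
          fun A hA _ => ?_
        rw [← withDensity_apply _ hA, ← withDensity_apply _ hA, hσs, hfP]
        exact hσP k n hkn A
      filter_upwards [this] with x hx _ using hx
    · exact Eventually.of_forall fun _ hkn' => absurd hkn' hkn
  have hσliminf : ∀ k, σ k ≤ l.withDensity fun x => liminf (fun n => f n x) atTop := by
    intro k
    rw [← hσs k]
    refine withDensity_mono ?_
    filter_upwards [hσf] with x hx
    exact le_liminf_of_le (by isBoundedDefault) (eventually_atTop.2 ⟨k, fun n hn => hx k n hn⟩)
  have hle : g ≤ᵐ[l] fun x => liminf (fun n => f n x) atTop := by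
    refine ae_le_of_forall_setLIntegral_le_of_sigmaFinite hg fun A hA _ => ?_
    rw [← withDensity_apply _ hA, ← withDensity_apply _ hA, hgQ, Measure.map_apply hZ hA]
    have hunion : Z ⁻¹' A = ⋃ k, (Z ⁻¹' A ∩ {ω | N ω ≤ k}) := by
      rw [← Set.inter_iUnion]
      refine (Set.inter_eq_left.2 fun ω _ => Set.mem_iUnion.2 ⟨N ω, Set.mem_ofPred.2 le_rfl⟩).symm
    have hmono : Monotone fun k => Z ⁻¹' A ∩ {ω | N ω ≤ k} := fun j k hjk ω hω =>
      ⟨hω.1, le_trans (Set.mem_ofPred.1 hω.2) hjk⟩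
    rw [hunion, hmono.measure_iUnion]
    refine iSup_le fun k => ?_
    have := hσliminf k A
    rwa [Measure.map_apply hZ hA, Measure.restrict_apply (hZ hA)] at this
  refine ⟨l, f, g, hf, hg, fun n => (hfP n).symm, hgQ.symm, ?_⟩
  have hg1 : ∫⁻ x, g x ∂l = 1 := by
    rw [← setLIntegral_univ, ← withDensity_apply _ .univ, hgQ, measure_univ]
  have hf1 : ∀ n, ∫⁻ x, f n x ∂l = 1 := fun n => by
    rw [← setLIntegral_univ, ← withDensity_apply _ .univ, hfP, measure_univ]
  -- By Fatou the liminf has mass at most 1, the mass of `g`, so the inequality `hle` is an equality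
  -- almost everywhere.
  refine (ae_eq_of_ae_le_of_lintegral_le hle (by simp [hg1]) hliminf.aemeasurable ?_).symm
  refine (lintegral_liminf_le hf).trans ?_
  simp [hf1, hg1]

/-! ### From convergence in density to couplings -/

/-- Convergence in density provides common parts of `P n` and `Q`, with densities `ρ n` with
respect to `Q` that eventually exceed every number smaller than `1`. -/
theorem TendstoInDensity.exists_ratio {X : Type*} [MeasurableSpace X] {P : ℕ → Measure X}
    {Q : Measure X} [IsFiniteMeasure Q] (h : TendstoInDensity P Q) :
    ∃ ρ : ℕ → X → ℝ≥0∞, (∀ n, Measurable (ρ n)) ∧ (∀ n x, ρ n x ≤ 1) ∧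
      (∀ n, Q.withDensity (ρ n) ≤ P n) ∧
      ∀ᵐ x ∂Q, ∀ u < 1, ∀ᶠ n in atTop, u < ρ n x := by
  obtain ⟨l, f, g, hf, hg, hP, hQ, hlim⟩ := h
  have hρ : ∀ n, Measurable fun x => min (f n x) (g x) / g x := fun n => by
    have := hf n
    fun_prop
  refine ⟨fun n x => min (f n x) (g x) / g x, hρ, fun n x => ?_, fun n => ?_, ?_⟩
  · exact (ENNReal.div_le_div_right (min_le_right _ _) _).trans ENNReal.div_self_le_one
  · rw [hQ, ← withDensity_mul _ hg (hρ n), hP n]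
    refine withDensity_mono (Eventually.of_forall fun x => ?_)
    exact ENNReal.mul_div_le.trans (min_le_left _ _)
  · have hgtop : ∀ᵐ x ∂l, g x < ∞ := by
      refine ae_lt_top hg ?_
      rw [← setLIntegral_univ, ← withDensity_apply _ .univ, ← hQ]
      exact measure_ne_top _ _
    rw [hQ, ae_withDensity_iff hg]
    filter_upwards [hlim, hgtop] with x hx hxtop hx0 u hu
    have hug : u * g x < g x := by
      refine ENNReal.mul_lt_of_lt_div ?_
      rwa [ENNReal.div_self hx0 hxtop.ne]
    have hev : ∀ᶠ n in atTop, u * g x < f n x :=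
      eventually_lt_of_lt_liminf (by rwa [hx])
    filter_upwards [hev] with n hn
    rw [ENNReal.lt_div_iff_mul_lt (Or.inl hx0) (Or.inl hxtop.ne)]
    exact lt_min hn hug

theorem unitInterval.volume_ofReal_lt {r : ℝ≥0∞} (hr : r ≤ 1) :
    volume {u : unitInterval | ENNReal.ofReal u < r} = r := by
  have hrtop : r ≠ ∞ := ne_top_of_le_ne_top ENNReal.one_ne_top hr
  have hr' : r.toReal ∈ Set.Icc (0 : ℝ) 1 :=
    ⟨ENNReal.toReal_nonneg, ENNReal.toReal_le_of_le_ofReal zero_le_one (by simpa using hr)⟩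
  have : {u : unitInterval | ENNReal.ofReal u < r} = Set.Iio ⟨r.toReal, hr'⟩ := by
    ext u
    exact ENNReal.ofReal_lt_iff_lt_toReal u.2.1 hrtop
  rw [this, unitInterval.volume_Iio]
  exact ENNReal.ofReal_toReal hrtop

/-- A measure `ν = ρ • Q` below the probability measure `P` is the distribution of `x ∼ Q` on the
event that `ρ x` exceeds an independent uniform variable; sampling from a suitable probability
measure `R` off that event produces a random element with distribution `P`. -/
theorem exists_residual_map_eq {X : Type*} [MeasurableSpace X] {P Q : Measure X}
    [IsProbabilityMeasure P] [IsProbabilityMeasure Q] {ρ : X → ℝ≥0∞} (hρ : Measurable ρ)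
    (hρ1 : ∀ x, ρ x ≤ 1) (h : Q.withDensity ρ ≤ P) :
    ∃ R : Measure X, IsProbabilityMeasure R ∧
      ((volume : Measure unitInterval).prod (Q.prod R)).map
        (fun p => if ENNReal.ofReal p.1 < ρ p.2.1 then p.2.1 else p.2.2) = P := by
  set ν := Q.withDensity ρ with hν
  have : IsFiniteMeasure ν := isFiniteMeasure_of_le P h
  have hadd : P - ν + ν = P := Measure.sub_add_cancel_of_le h
  have hres : ∫⁻ x, (1 - ρ x) ∂Q = (P - ν) Set.univ := by
    rw [lintegral_sub hρ _ (Eventually.of_forall hρ1), Measure.sub_apply .univ h, hν,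
      withDensity_apply _ .univ]
    · simp
    · rw [← setLIntegral_univ, ← withDensity_apply _ .univ]
      exact measure_ne_top ν _
  -- `R` is the normalized residual. If the residual vanishes any probability measure will do, and
  -- `P` is taken.
  obtain ⟨R, hR, hRP⟩ : ∃ R : Measure X, IsProbabilityMeasure R ∧
      ((P - ν) Set.univ) • R = P - ν := by
    by_cases h0 : P - ν = 0
    · exact ⟨P, inferInstance, by simp [h0]⟩
    · have h0' : (P - ν) Set.univ ≠ 0 := fun h => h0 (Measure.measure_univ_eq_zero.1 h)
      refine ⟨((P - ν) Set.univ)⁻¹ • (P - ν), ⟨?_⟩, ?_⟩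
      · simp [ENNReal.inv_mul_cancel h0' (measure_ne_top _ _)]
      · rw [smul_smul, ENNReal.mul_inv_cancel h0' (measure_ne_top _ _), one_smul]
  refine ⟨R, hR, ?_⟩
  have hset : MeasurableSet {p : unitInterval × X × X | ENNReal.ofReal p.1 < ρ p.2.1} :=
    measurableSet_lt (by fun_prop) (by fun_prop)
  have hΦ : Measurable fun p : unitInterval × X × X =>
      if ENNReal.ofReal p.1 < ρ p.2.1 then p.2.1 else p.2.2 :=
    Measurable.ite hset (by fun_prop) (by fun_prop)
  ext B hB
  rw [Measure.map_apply hΦ hB, Measure.prod_apply_symm (hΦ hB)]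
  -- Integrating out the uniform variable first: the first point is kept with probability `ρ p.1`,
  -- the second with the complementary probability.
  have hsection : ∀ p : X × X, volume ((fun u : unitInterval => (u, p)) ⁻¹'
      ((fun p : unitInterval × X × X =>
        if ENNReal.ofReal p.1 < ρ p.2.1 then p.2.1 else p.2.2) ⁻¹' B)) =
      B.indicator ρ p.1 + (1 - ρ p.1) * B.indicator 1 p.2 := by
    intro p
    have hlt : MeasurableSet {u : unitInterval | ENNReal.ofReal u < ρ p.1} :=
      measurableSet_lt (by fun_prop) measurable_const
    have hc : volume {u : unitInterval | ENNReal.ofReal u < ρ p.1}ᶜ = 1 - ρ p.1 := by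
      rw [prob_compl_eq_one_sub hlt, unitInterval.volume_ofReal_lt (hρ1 _)]
    have hpre : (fun u : unitInterval => (u, p)) ⁻¹' ((fun p : unitInterval × X × X =>
        if ENNReal.ofReal p.1 < ρ p.2.1 then p.2.1 else p.2.2) ⁻¹' B) =
        {u : unitInterval | ENNReal.ofReal u < ρ p.1 ∧ p.1 ∈ B} ∪
          {u : unitInterval | ¬ ENNReal.ofReal u < ρ p.1 ∧ p.2 ∈ B} := by
      ext u
      by_cases hu : ENNReal.ofReal u < ρ p.1 
      · simp [hu]
      · simp [hu, not_lt.1 hu]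
    rw [hpre, measure_union]
    · congr 1
      · by_cases h1 : p.1 ∈ B
        · simpa [h1] using unitInterval.volume_ofReal_lt (hρ1 p.1)
        · simp [h1]
      · by_cases h2 : p.2 ∈ B
        · simp only [h2, and_true, Set.indicator_of_mem, Pi.one_apply, mul_one]
          exact hc
        · simp [h2]
    · exact Set.disjoint_left.2 fun u hu hu' => hu'.1 hu.1
    · by_cases h2 : p.2 ∈ B
      · simp only [h2, and_true]
        exact hlt.compl
      · simp [h2]
  have hind : Measurable (B.indicator ρ) := hρ.indicator hB
  have hind1 : Measurable (B.indicator (1 : X → ℝ≥0∞)) := measurable_one.indicator hB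
  rw [lintegral_congr hsection, lintegral_add_left (by fun_prop)]
  have h1 : ∫⁻ p, B.indicator ρ p.1 ∂(Q.prod R) = ν B := by
    rw [lintegral_prod _ (by fun_prop)]
    simp only [lintegral_const, measure_univ, mul_one]
    rw [lintegral_indicator hB, hν, withDensity_apply _ hB]
  have h2 : ∫⁻ p, (1 - ρ p.1) * B.indicator 1 p.2 ∂(Q.prod R) = (P - ν) B := by
    rw [lintegral_prod_mul (f := fun x => 1 - ρ x) (g := B.indicator 1) (by fun_prop)
      hind1.aemeasurable, hres, lintegral_indicator_one hB]
    exact congrArg (fun κ : Measure X => κ B) hRP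
  rw [h1, h2, add_comm, ← Measure.add_apply, hadd]

/-- Diagonal selection: events that eventually occur almost surely for each `m` also eventually
occur along some `m n → ∞`. -/
theorem exists_diagonal_ae_eventually {Ω : Type*} [MeasurableSpace Ω] (μ : Measure Ω)
    [IsFiniteMeasure μ] {A : ℕ → ℕ → Set Ω} (hA : ∀ m n, MeasurableSet (A m n))
    (h : ∀ m, ∀ᵐ ω ∂μ, ∀ᶠ n in atTop, ω ∈ A m n) :
    ∃ m : ℕ → ℕ, Monotone m ∧ Tendsto m atTop atTop ∧
      ∀ᵐ ω ∂μ, ∀ᶠ n in atTop, ω ∈ A (m n) n := by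
  -- `B m k` is the event that `A m n` fails for some `n ≥ k`. Its measure vanishes as `k → ∞`, so
  -- times `φ m` can be chosen to make these measures summable in `m`.
  let B : ℕ → ℕ → Set Ω := fun m k => ⋃ n ≥ k, (A m n)ᶜ
  have hB : ∀ m, Tendsto (fun k => μ (B m k)) atTop (𝓝 0) := by
    intro m
    have hanti : Antitone (B m) := fun j k hjk =>
      Set.biUnion_subset_biUnion_left fun n hn => le_trans hjk hn
    have hlim := tendsto_measure_iInter_atTop (μ := μ) (s := B m)
      (fun k => (MeasurableSet.biUnion (Set.to_countable _) fun n _ =>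
        (hA m n).compl).nullMeasurableSet) hanti ⟨0, measure_ne_top _ _⟩
    have hnull : μ (⋂ k, B m k) = 0 := by
      refine measure_mono_null (fun ω hω => ?_) (h m)
      rw [Set.mem_iInter] at hω
      simp only [Set.mem_compl_iff, Set.mem_ofPred, eventually_atTop, not_exists]
      intro k hk
      obtain ⟨n, hn, hωn⟩ := Set.mem_iUnion₂.1 (hω k)
      exact hωn (hk n hn)
    rwa [hnull] at hlim
  obtain ⟨φ, hφ, hφB⟩ := extraction_forall_of_eventually
    (P := fun m k => μ (B m k) ≤ (2⁻¹ : ℝ≥0∞) ^ m) fun m =>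
      (hB m).eventually_le_const (ENNReal.pow_pos (by simp) m)
  have hBC : ∀ᵐ ω ∂μ, ∀ᶠ m in atTop, ω ∉ B m (φ m) := by
    refine ae_eventually_notMem (ne_top_of_le_ne_top ?_ (ENNReal.tsum_le_tsum hφB))
    rw [ENNReal.tsum_geometric]
    simp
  -- The largest `j ≤ n` with `φ j ≤ n`. The default value 0 carries no information while `n < φ 0`,
  -- hence the restriction to `n ≥ φ 0` below.
  let m : ℕ → ℕ := fun n => Nat.findGreatest (fun j => φ j ≤ n) n
  have hmt : Tendsto m atTop atTop := by
    refine tendsto_atTop.2 fun j => ?_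
    filter_upwards [eventually_ge_atTop (φ j)] with n hn
    exact Nat.le_findGreatest (hφ.le_apply.trans hn) hn
  refine ⟨m, fun a b hab => Nat.findGreatest_mono (fun j hj => le_trans hj hab) hab, hmt, ?_⟩
  filter_upwards [hBC] with ω hω
  filter_upwards [hmt.eventually hω, eventually_ge_atTop (φ 0)] with n hn hn0
  have hspec : φ (m n) ≤ n :=
    Nat.findGreatest_spec (P := fun j => φ j ≤ n) (Nat.zero_le n) hn0
  by_contra hcon
  exact hn (Set.mem_iUnion₂.2 ⟨n, hspec, hcon⟩)

theorem IsWindowCoupling.comp {S E Ω Ω' : Type*} [TopologicalSpace S] [MeasurableSpace S]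
    [MeasurableSpace E] [MeasurableSpace Ω] [MeasurableSpace Ω']
    {P : ℕ → Measure (SkorohodSpace S × E)} {Q : Measure (SkorohodSpace S × E)} {t : ℕ → ℝ≥0}
    {μ : Measure Ω} {μ' : Measure Ω'} {Y : (n : ℕ) → Ω → WindowSpace S (t n)}
    {X : Ω → SkorohodSpace S × E} {N : Ω → ℕ} (h : IsWindowCoupling P Q t μ Y X N)
    {π : Ω' → Ω} (hπ : MeasurePreserving π μ' μ) :
    IsWindowCoupling P Q t μ' (fun n => Y n ∘ π) (X ∘ π) (N ∘ π) where
  prob := ⟨by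
    have := h.prob
    rw [← Set.preimage_univ (f := π), hπ.measure_preimage MeasurableSet.univ.nullMeasurableSet,
      measure_univ]⟩
  window n := ⟨(h.window n).measurable.comp hπ.measurable, by
    rw [← Measure.map_map (h.window n).measurable hπ.measurable, hπ.map_eq, (h.window n).map_eq]⟩
  limit := ⟨h.limit.measurable.comp hπ.measurable, by
    rw [← Measure.map_map h.limit.measurable hπ.measurable, hπ.map_eq, h.limit.map_eq]⟩
  measurable_time := h.measurable_time.comp hπ.measurable
  eq_of_le ω n hn := h.eq_of_le (π ω) n hn

section Coupling

variable {S : Type uS} [TopologicalSpace S] [PolishSpace S] [MeasurableSpace S] [BorelSpace S]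

/-- Gluing a fixed path `x` behind a segment embeds the window space in the standard Borel path
space, where the law can be sampled. Restricting the sample recovers `R`. -/
theorem WindowSpace.exists_measurable_map_eq {t : ℝ≥0} (x : SkorohodSpace S)
    (R : Measure (WindowSpace S t)) [IsProbabilityMeasure R] :
    ∃ W : unitInterval → WindowSpace S t, Measurable W ∧ volume.map W = R := by
  have : Nonempty (SkorohodSpace S) := ⟨x⟩
  have hglue : Measurable fun w : WindowSpace S t => SkorohodSpace.glue t w x :=
    (SkorohodSpace.measurable_glue t).comp (measurable_id.prodMk measurable_const)
  have hseg : Measurable fun y : SkorohodSpace S => timeSegment t (y, ()) :=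
    (measurable_timeSegment t).comp (measurable_id.prodMk measurable_const)
  have : IsProbabilityMeasure (R.map fun w => SkorohodSpace.glue t w x) :=
    Measure.isProbabilityMeasure_map hglue.aemeasurable
  obtain ⟨G, hG, hGmap⟩ := (R.map fun w => SkorohodSpace.glue t w x).exists_measurable_map_eq
  refine ⟨fun u => timeSegment t (G u, ()), hseg.comp hG, ?_⟩
  change volume.map ((fun y => timeSegment t (y, ())) ∘ G) = R
  rw [← Measure.map_map hseg hG, hGmap, Measure.map_map hseg hglue]
  convert Measure.map_id using 2
  funext w
  exact timeSegment_glue t w x ()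

variable {E : Type uE} [MeasurableSpace E] [StandardBorelSpace E]

theorem exists_windowCoupling_of_tendstoInDensity (P : ℕ → Measure (SkorohodSpace S × E))
    [∀ n, IsProbabilityMeasure (P n)] (Q : Measure (SkorohodSpace S × E)) [IsProbabilityMeasure Q]
    (h : ∀ t, TendstoInDensity (fun n => (P n).map (timeSegment t)) (Q.map (timeSegment t))) :
    ∃ (t : ℕ → ℝ≥0) (Ω : Type w) (_ : MeasurableSpace Ω) (μ : Measure Ω)
      (Y : (n : ℕ) → Ω → WindowSpace S (t n)) (X : Ω → SkorohodSpace S × E) (N : Ω → ℕ),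
      IsWidening t ∧ IsWindowCoupling P Q t μ Y X N := by
  classical
  have hseg : ∀ t, Measurable (timeSegment t : SkorohodSpace S × E → WindowSpace S t) :=
    measurable_timeSegment
  have hPp : ∀ n t, IsProbabilityMeasure ((P n).map (timeSegment t)) := fun n t =>
    Measure.isProbabilityMeasure_map (hseg t).aemeasurable
  have hQp : ∀ t, IsProbabilityMeasure (Q.map (timeSegment t)) := fun t =>
    Measure.isProbabilityMeasure_map (hseg t).aemeasurable
  have hne : Nonempty (SkorohodSpace S × E) := Q.nonempty_of_neZero
  obtain ⟨z₀⟩ := id hne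
  choose ρ hρ hρ1 hρP hρlim using fun m : ℕ => (h m).exists_ratio
  obtain ⟨F, hF, hFQ⟩ := Q.exists_measurable_map_eq
  -- The three uniform coordinates decide acceptance, generate the limit `X`, and generate the
  -- residual segments. All `n` share them; a common acceptance variable makes acceptance eventually
  -- permanent.
  let μ : Measure (unitInterval × unitInterval × unitInterval) :=
    volume.prod (volume.prod volume)
  let A : ℕ → ℕ → Set (unitInterval × unitInterval × unitInterval) := fun m n =>
    {ω | ENNReal.ofReal ω.1 < ρ m n (timeSegment m (F ω.2.1))}
  have hA : ∀ m n, MeasurableSet (A m n) := fun m n =>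
    measurableSet_lt (by fun_prop)
      ((hρ m n).comp ((hseg m).comp (hF.comp (measurable_fst.comp measurable_snd))))
  have hAev : ∀ m, ∀ᵐ ω ∂μ, ∀ᶠ n in atTop, ω ∈ A m n := by
    intro m
    -- The ratios are only known to exceed numbers strictly below 1.
    have h1 : ∀ᵐ ω ∂μ, ω.1 ≠ 1 := by
      have : ∀ᵐ u : unitInterval, u ≠ 1 := by simp [ae_iff]
      exact Measure.quasiMeasurePreserving_fst.ae this
    have hmap : MeasurePreserving (fun u => timeSegment (m : ℝ≥0) (F u)) volume
        (Q.map (timeSegment (m : ℝ≥0))) :=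
      (MeasurePreserving.mk (hseg m) rfl).comp ⟨hF, hFQ⟩
    have h2 := ((hmap.quasiMeasurePreserving.comp Measure.quasiMeasurePreserving_fst).comp
      (Measure.quasiMeasurePreserving_snd (μ := (volume : Measure unitInterval))
        (ν := (volume : Measure unitInterval).prod (volume : Measure unitInterval)))).ae (hρlim m)
    filter_upwards [h1, h2] with ω hω1 hω2
    refine hω2 _ ?_
    rw [ENNReal.ofReal_lt_one]
    exact lt_of_le_of_ne ω.1.2.2 fun heq => hω1 (Subtype.ext heq)
  obtain ⟨m, hmono, hmt, hmA⟩ := exists_diagonal_ae_eventually μ hA hAev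
  have hres := fun n => exists_residual_map_eq (P := (P n).map (timeSegment (m n : ℝ≥0)))
    (hρ (m n) n) (hρ1 (m n) n) (hρP (m n) n)
  choose R hR hRP using hres
  choose W hW hWR using fun n => WindowSpace.exists_measurable_map_eq z₀.1 (R n)
  let G : Set (unitInterval × unitInterval × unitInterval) := {ω | ∀ᶠ n in atTop, ω ∈ A (m n) n}
  have hAn : ∀ k, MeasurableSet {ω | ∀ n ≥ k, ω ∈ A (m n) n} := fun k => by
    simp only [Set.ofPred_forall]
    exact .iInter fun n => .iInter fun _ => hA (m n) n
  have hG : MeasurableSet G := by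
    simp only [G, eventually_atTop, Set.ofPred_exists]
    exact .iUnion hAn
  let X : unitInterval × unitInterval × unitInterval → SkorohodSpace S × E := fun ω => F ω.2.1
  have hX : Measurable X := hF.comp (measurable_fst.comp measurable_snd)
  let Y₀ : (n : ℕ) → unitInterval × unitInterval × unitInterval → WindowSpace S (m n : ℝ≥0) :=
    fun n ω => if ω ∈ A (m n) n then timeSegment (m n) (X ω) else W n ω.2.2
  have hY₀ : ∀ n, Measurable (Y₀ n) := fun n =>
    Measurable.ite (hA (m n) n) ((hseg _).comp hX)
      ((hW n).comp (measurable_snd.comp measurable_snd))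
  -- Off the almost sure event `G` the segments of `X` are used, so that agreement from a finite
  -- time on holds for every `ω`. There `p` is vacuous and the time is 0.
  let Y : (n : ℕ) → unitInterval × unitInterval × unitInterval → WindowSpace S (m n : ℝ≥0) :=
    fun n ω => if ω ∈ G then Y₀ n ω else timeSegment (m n) (X ω)
  have hY : ∀ n, Measurable (Y n) := fun n =>
    Measurable.ite hG (hY₀ n) ((hseg _).comp hX)
  have hY₀map : ∀ n, μ.map (Y₀ n) = (P n).map (timeSegment (m n : ℝ≥0)) := by
    intro n
    have hmap : MeasurePreserving (fun u => timeSegment (m n : ℝ≥0) (F u)) volume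
        (Q.map (timeSegment (m n : ℝ≥0))) :=
      (MeasurePreserving.mk (hseg _) rfl).comp ⟨hF, hFQ⟩
    have hprod := (MeasurePreserving.id (volume : Measure unitInterval)).prod
      (hmap.prod ⟨hW n, hWR n⟩)
    rw [← hRP n, ← hprod.map_eq, Measure.map_map ?_ hprod.measurable]
    · rfl
    · exact Measurable.ite (measurableSet_lt (by fun_prop)
        ((hρ (m n) n).comp (measurable_fst.comp measurable_snd))) (by fun_prop) (by fun_prop)
  let p : unitInterval × unitInterval × unitInterval → ℕ → Prop := fun ω k =>
    ω ∈ G → ∀ n ≥ k, ω ∈ A (m n) n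
  have hp : ∀ ω, ∃ k, p ω k := by
    intro ω
    by_cases hω : ω ∈ G
    · obtain ⟨k, hk⟩ := eventually_atTop.1 hω
      exact ⟨k, fun _ => hk⟩
    · exact ⟨0, fun hω' => absurd hω' hω⟩
  have hN : Measurable fun ω => Nat.find (hp ω) := measurable_find hp fun k => by
    have : {ω | p ω k} = Gᶜ ∪ {ω | ∀ n ≥ k, ω ∈ A (m n) n} := by
      ext ω
      exact imp_iff_not_or
    rw [this]
    exact hG.compl.union (hAn k)
  have hcoupling : IsWindowCoupling P Q (fun n => (m n : ℝ≥0)) μ Y X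
      (fun ω => Nat.find (hp ω)) := by
    refine ⟨inferInstance, fun n => ⟨hY n, ?_⟩, ⟨hX, ?_⟩, hN, fun ω n hn => ?_⟩
    · rw [← hY₀map n]
      refine Measure.map_congr ?_
      filter_upwards [hmA] with ω hω
      exact if_pos hω
    · have : MeasurePreserving X μ Q :=
        (MeasurePreserving.mk hF hFQ).comp (measurePreserving_fst.comp measurePreserving_snd)
      exact this.map_eq
    · by_cases hω : ω ∈ G
      · exact (if_pos hω).trans (if_pos (Nat.find_spec (hp ω) hω n hn))
      · exact if_neg hω
  -- Lifting moves the concrete probability space to the universe `w` of the statement.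
  let e : ULift.{w} (unitInterval × unitInterval × unitInterval) ≃ᵐ
      unitInterval × unitInterval × unitInterval := MeasurableEquiv.ulift
  have hlift : MeasurePreserving e (μ.map e.symm) μ :=
    MeasurePreserving.symm e.symm (e.symm.measurable.measurePreserving μ)
  refine ⟨fun n => m n, ULift.{w} (unitInterval × unitInterval × unitInterval), inferInstance, _,
    _, _, _, ⟨fun a b hab => Nat.cast_le.2 (hmono hab), tendsto_natCast_atTop_atTop.comp hmt⟩,
    hcoupling.comp hlift⟩

end Coupling

/-! ### Assembling the equivalence -/

theorem IsFullCoupling.tendstoInDensity {S E Ω : Type*} [TopologicalSpace S] [MeasurableSpace S]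
    [MeasurableSpace E] [MeasurableSpace Ω] {P : ℕ → Measure (SkorohodSpace S × E)}
    {Q : Measure (SkorohodSpace S × E)} {t : ℕ → ℝ≥0} {μ : Measure Ω}
    {Y : ℕ → Ω → SkorohodSpace S × E} {X : Ω → SkorohodSpace S × E} {N : Ω → ℕ}
    (h : IsFullCoupling P Q t μ Y X N) (ht : IsWidening t) (s : ℝ≥0) :
    TendstoInDensity (fun n => (P n).map (timeSegment s)) (Q.map (timeSegment s)) := by
  have := h.prob
  have hseg : Measurable (timeSegment s : SkorohodSpace S × E → WindowSpace S s) :=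
    measurable_timeSegment s
  obtain ⟨k, hk⟩ := eventually_atTop.1 (ht.tendsto.eventually_ge_atTop s)
  -- From index `k` on, `[0,s)` lies inside `[0,t n)`, so the maximum of `N` and `k` is an agreement
  -- time for the window `[0,s)`.
  have hmain := tendstoInDensity_of_eventually_eq μ (fun n => hseg.comp (h.element n).measurable)
    (hseg.comp h.limit.measurable) (h.measurable_time.max (measurable_const (a := k)))
    fun ω n hn => timeSegment_eq_of_le (hk n ((le_max_right _ _).trans hn))
      (h.eq_of_le ω n ((le_max_left _ _).trans hn))
  simp only [← Measure.map_map hseg (h.element _).measurable, (h.element _).map_eq,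
    ← Measure.map_map hseg h.limit.measurable, h.limit.map_eq] at hmain
  exact hmain

theorem corollary4
    {S : Type uS} [TopologicalSpace S] [PolishSpace S] [MeasurableSpace S] [BorelSpace S]
    {E : Type uE} [TopologicalSpace E] [PolishSpace E] [MeasurableSpace E] [BorelSpace E]
    -- the given random elements, each on a probability space of its own
    {Ωs : ℕ → Type u} [∀ n, MeasurableSpace (Ωs n)] (ℙs : (n : ℕ) → Measure (Ωs n))
    [∀ n, IsProbabilityMeasure (ℙs n)]
    {Ωl : Type v} [MeasurableSpace Ωl] (ℙl : Measure Ωl) [IsProbabilityMeasure ℙl]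
    (Zs : (n : ℕ) → Ωs n → SkorohodSpace S × E) (hZs : ∀ n, Measurable (Zs n))
    (Z : Ωl → SkorohodSpace S × E) (hZ : Measurable Z) :
    -- every coupling of the windows extends to a full coupling
    (∀ (t : ℕ → ℝ≥0), IsWidening t →
      ∀ (Ω : Type w) [MeasurableSpace Ω] (μ : Measure Ω)
        (Y : (n : ℕ) → Ω → WindowSpace S (t n)) (X : Ω → SkorohodSpace S × E) (N : Ω → ℕ),
        IsWindowCoupling (fun n => (ℙs n).map (Zs n)) (ℙl.map Z) t μ Y X N →
        ∃ (Ω' : Type w) (_ : MeasurableSpace Ω') (μ' : Measure Ω') (π : Ω' → Ω)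
          (Y' : ℕ → Ω' → SkorohodSpace S × E),
          MeasurePreserving π μ' μ ∧
          IsFullCoupling (fun n => (ℙs n).map (Zs n)) (ℙl.map Z) t μ' Y' (X ∘ π) (N ∘ π) ∧
          ∀ n ω', timeSegment (t n) (Y' n ω') = Y n (π ω')) ∧
    -- and such couplings exist exactly under convergence in density in all finite windows
    ((∀ t : ℝ≥0, TendstoInDensity (fun n => (ℙs n).map (fun ω => timeSegment t (Zs n ω)))
        (ℙl.map (fun ω => timeSegment t (Z ω)))) ↔
      ∃ (t : ℕ → ℝ≥0) (Ω : Type w) (_ : MeasurableSpace Ω) (μ : Measure Ω)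
        (Y : ℕ → Ω → SkorohodSpace S × E) (X : Ω → SkorohodSpace S × E) (N : Ω → ℕ),
        IsWidening t ∧ IsFullCoupling (fun n => (ℙs n).map (Zs n)) (ℙl.map Z) t μ Y X N) := by
  have hP : ∀ n, IsProbabilityMeasure ((ℙs n).map (Zs n)) := fun n =>
    Measure.isProbabilityMeasure_map (hZs n).aemeasurable
  have hQ : IsProbabilityMeasure (ℙl.map Z) := Measure.isProbabilityMeasure_map hZ.aemeasurable
  refine ⟨fun t _ Ω _ μ Y X N h => exists_fullCoupling_of_windowCoupling _ _ t Ω μ Y X N h, ?_⟩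
  have hmap : ∀ t : ℝ≥0,
      TendstoInDensity (fun n => (ℙs n).map (fun ω => timeSegment t (Zs n ω)))
        (ℙl.map (fun ω => timeSegment t (Z ω))) ↔
      TendstoInDensity (fun n => ((ℙs n).map (Zs n)).map (timeSegment t))
        ((ℙl.map Z).map (timeSegment t)) := by
    intro t
    simp only [Measure.map_map (measurable_timeSegment t) (hZs _),
      Measure.map_map (measurable_timeSegment t) hZ, Function.comp_def]
  simp only [hmap]
  constructor
  · intro h
    obtain ⟨t, Ω, _, μ, Y, X, N, ht, hc⟩ :=
      exists_windowCoupling_of_tendstoInDensity.{uS, uE, w} _ _ h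
    obtain ⟨Ω', _, μ', π, Y', -, hfull, -⟩ :=
      exists_fullCoupling_of_windowCoupling _ _ t Ω μ Y X N hc
    exact ⟨t, Ω', _, μ', Y', _, _, ht, hfull⟩
  · rintro ⟨t, Ω, _, μ, Y, X, N, ht, hc⟩ s
    exact hc.tendstoInDensity ht s
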